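/- Let $\mathrm{Sg}(x)=1$ if $x\ge 0$ and $\mathrm{Sg}(x)=-1$ if $x<0$, and let $(x;q)_\infty=\prod_{i=0}^{\infty}(1-xq^{i})$. For all integers $a,b$ and every integer $k\ge 1$, the coefficient of $q^k$ in the formal power series $$\frac{\mathrm{Sg}(a+b)}{(q^2;q^2)_\infty^{3}\,(q^2;q^4)_\infty^{2}}\sum_{n=a}^{b}(6n+1)q^{3n^2+n}$$ is non-negative, where the sum is $0$ if $a>b$. -/

import Mathlib

open PowerSeries
open scoped PowerSeries.WithPiTopology

/-- `Sg x = 1` if `x ≥ 0` and `Sg x = -1` if `x < 0` (in particular `Sg 0 = 1`). -/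
def Sg (x : ℤ) : ℤ := if 0 ≤ x then 1 else -1

/-- The `q`-shifted factorial `(a; q)_∞ = ∏_{i ≥ 0} (1 - a q^i)`, an infinite product in the ring
of formal power series with its usual topology of coefficientwise convergence. -/
noncomputable def qPochInf (a q : ℚ⟦X⟧) : ℚ⟦X⟧ := ∏' i : ℕ, (1 - a * q ^ i)

/-- The infinite product converges as soon as `q` has no constant term. -/
theorem multipliable_qPochInf (a q : ℚ⟦X⟧) (hq : constantCoeff q = 0) :
    Multipliable fun i : ℕ => 1 - a * q ^ i := by
  simp_rw [sub_eq_add_neg]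
  apply WithPiTopology.multipliable_one_add_of_tendsto_order_atTop_nhds_top
  refine ENat.tendsto_nhds_top_iff_natCast_lt.mpr
    (fun n => Filter.eventually_atTop.mpr ⟨n + 1, fun m hm => ?_⟩)
  rw [order_neg]
  have h1 : (X : ℚ⟦X⟧) ^ m ∣ a * q ^ m :=
    Dvd.dvd.mul_left (pow_dvd_pow_of_dvd (X_dvd_iff.mpr hq) m) a
  have h2 : (m : ℕ∞) ≤ (a * q ^ m).order := by
    apply nat_le_order
    intro i hi
    exact X_pow_dvd_iff.mp h1 i hi
  refine lt_of_lt_of_le ?_ h2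
  exact_mod_cast hm

/-- If `a` and `q` have no constant term then `(a; q)_∞` has constant term `1`,
so it is invertible. -/
theorem constantCoeff_qPochInf (a q : ℚ⟦X⟧) (ha : constantCoeff a = 0)
    (hq : constantCoeff q = 0) : constantCoeff (qPochInf a q) = 1 := by
  unfold qPochInf
  rw [(multipliable_qPochInf a q hq).map_tprod _ (WithPiTopology.continuous_constantCoeff ℚ)]
  simp [ha]

/-- The exponent `3n² + n` is non-negative for every integer `n`, so that taking it as a natural
number loses nothing. -/
theorem exponent_nonneg (n : ℤ) : 0 ≤ 3 * n ^ 2 + n := by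
  rcases le_or_gt 0 n with h | h <;> nlinarith

/-- The finite sum `∑_{n=a}^{b} (6n+1) q^{3n²+n}` (empty if `a > b`), where `q = X`. -/
noncomputable def truncSum (a b : ℤ) : ℚ⟦X⟧ :=
  ∑ n ∈ Finset.Icc a b, (6 * (n : ℚ⟦X⟧) + 1) * X ^ (3 * n ^ 2 + n).toNat

/-- The product `(q²; q²)_∞³ (q²; q⁴)_∞²`, where `q = X`. -/
noncomputable def prodSide : ℚ⟦X⟧ :=
  qPochInf (X ^ 2) (X ^ 2) ^ 3 * qPochInf (X ^ 2) (X ^ 4) ^ 2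

/-- The product is invertible, so its inverse below is the genuine one. -/
theorem prodSide_mul_inv : prodSide * prodSide⁻¹ = 1 := by
  apply PowerSeries.mul_inv_cancel
  simp [prodSide, constantCoeff_qPochInf]

/-! Put Q = q². Letting z → 1 in the quintuple product identity gives ∑ (6n+1) q^(3n²+n) =
(q²;q²)_∞³ (q²;q⁴)_∞² over all integers n. The inverse product has non-negative coefficients, and
6n+1 has the sign of n (positive at 0), so the theorem reduces to the balanced ranges [-A, A] and
[-B-1, B]; the remaining terms all have the favourable sign.

For balanced ranges a finite identity is telescoped. `evenTerm` at level s is a finite version of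
the terms n = ±a together, `oddTerm` of the terms n = b and n = -b-1. The change of a term from
level s to s+1 is, up to sign, the change of a boundary term from one index to the next
(`evenBoundary_succ_sub`, `oddBoundary_succ_sub`). Summing over indices and levels leaves the
boundary just past the range and the one at the bottom. The latter vanishes by the symmetry z ↦ z⁻¹
(`antisymValue_evenBoundary_zero_add_one`, `antisymValue_oddBoundary_zero`); the former is
non-negative (`evenBoundary_mem`, `oddBoundary_mem`). Hence the truncated sum over the product is 1
plus a non-negative series on [-A, A], and 1 minus one on [-B-1, B].

The limit z → 1 needs only first-order data, so z is the dual number 1 + ε. The limit in the level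
is replaced by congruences modulo powers of Q. -/

/-! ### Telescoping for the finite quintuple product identity -/

section Generic

variable {S : Type*} [CommRing S]

/-- The Gaussian binomial coefficient, defined by the `q`-Pascal recursion. -/
def gauss (q : S) : ℕ → ℕ → S
  | _, 0 => 1
  | 0, _ + 1 => 0
  | n + 1, k + 1 => gauss q n k + q ^ (k + 1) * gauss q n (k + 1)

/-- The Gaussian binomial coefficient `[n, k - 1]`, which vanishes for `k = 0`. -/
def gaussPred (q : S) (n : ℕ) : ℕ → S
  | 0 => 0
  | k + 1 => gauss q n k

/-- `∏_{1 ≤ i ≤ n} (1 - c q^i)`. -/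
def poch (c q : S) (n : ℕ) : S := ∏ i ∈ Finset.range n, (1 - c * q ^ (i + 1))

/-- `∏_{1 ≤ i ≤ n} (1 - c q^i)⁻¹`. -/
noncomputable def invPoch (c q : S) (n : ℕ) : S :=
  ∏ i ∈ Finset.range n, Ring.inverse (1 - c * q ^ (i + 1))

/-- `∏_{1 ≤ i ≤ n} (c - q^i)⁻¹`. -/
noncomputable def invPochRev (c q : S) (n : ℕ) : S :=
  ∏ i ∈ Finset.range n, Ring.inverse (c - q ^ (i + 1))

/-- `∏_{1 ≤ i ≤ n} (1 + z q^i) (z + q^i)`. -/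
def symNum (q z : S) (n : ℕ) : S :=
  ∏ i ∈ Finset.range n, ((1 + z * q ^ (i + 1)) * (z + q ^ (i + 1)))

lemma gauss_eq_zero (q : S) {n k : ℕ} (h : n < k) : gauss q n k = 0 := by
  induction n generalizing k with
  | zero => cases k with
    | zero => omega
    | succ k => rfl
  | succ n ih => cases k with
    | zero => omega
    | succ k => simp [gauss, ih (show n < k by omega), ih (show n < k + 1 by omega)]

lemma gauss_self (q : S) (n : ℕ) : gauss q n n = 1 := by
  induction n with
  | zero => rfl
  | succ n ih => simp [gauss, ih, gauss_eq_zero q (Nat.lt_succ_self n)]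

lemma poch_succ (c q : S) (n : ℕ) : poch c q (n + 1) = poch c q n * (1 - c * q ^ (n + 1)) := by
  simp [poch, Finset.prod_range_succ]

lemma gauss_mul_poch (q : S) (i j : ℕ) :
    gauss q (i + j) i * (poch 1 q i * poch 1 q j) = poch 1 q (i + j) := by
  induction h : i + j generalizing i j with
  | zero =>
    obtain ⟨rfl, rfl⟩ : i = 0 ∧ j = 0 := by omega
    simp [gauss, poch]
  | succ n ih =>
    rcases i with _ | i
    · obtain rfl : j = n + 1 := by omega
      simp [gauss, poch]
    rcases j with _ | j
    · obtain rfl : i = n := by omega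
      simp [gauss_self, poch]
    have h1 := ih i (j + 1) (by omega)
    have h2 := ih (i + 1) j (by omega)
    have h3 : n = i + j + 1 := by omega
    subst h3
    rw [gauss]
    rw [poch_succ 1 q i] at h2 ⊢
    rw [poch_succ 1 q j] at h1 ⊢
    rw [poch_succ 1 q (i + j + 1)]
    linear_combination (1 - q ^ (i + 1)) * h1 + q ^ (i + 1) * (1 - q ^ (j + 1)) * h2

lemma invPoch_eq_mul (c q : S) (n : ℕ) (h : IsUnit (1 - c * q ^ (n + 1))) :
    invPoch c q n = invPoch c q (n + 1) * (1 - c * q ^ (n + 1)) := by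
  rw [invPoch, invPoch, Finset.prod_range_succ, mul_assoc, Ring.inverse_mul_cancel _ h, mul_one]

lemma invPochRev_eq_mul (c q : S) (n : ℕ) (h : IsUnit (c - q ^ (n + 1))) :
    invPochRev c q n = invPochRev c q (n + 1) * (c - q ^ (n + 1)) := by
  rw [invPochRev, invPochRev, Finset.prod_range_succ, mul_assoc, Ring.inverse_mul_cancel _ h,
    mul_one]

lemma symNum_succ (q z : S) (n : ℕ) :
    symNum q z (n + 1) = symNum q z n * ((1 + z * q ^ (n + 1)) * (z + q ^ (n + 1))) := by
  simp [symNum, Finset.prod_range_succ]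

lemma poch_mul_invPoch (c q : S) (h : ∀ n, IsUnit (1 - c * q ^ (n + 1))) (n : ℕ) :
    poch c q n * invPoch c q n = 1 := by
  rw [poch, invPoch, ← Finset.prod_mul_distrib]
  exact Finset.prod_eq_one fun i _ => Ring.mul_inverse_cancel _ (h i)

lemma gauss_eq (q : S) (h : ∀ n, IsUnit (1 - 1 * q ^ (n + 1))) (i j : ℕ) :
    gauss q (i + j) i = poch 1 q (i + j) * (invPoch 1 q i * invPoch 1 q j) := by
  linear_combination (invPoch 1 q i * invPoch 1 q j) * gauss_mul_poch q i j
    - gauss q (i + j) i * poch_mul_invPoch 1 q h i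
    - gauss q (i + j) i * poch 1 q i * invPoch 1 q i * poch_mul_invPoch 1 q h j

/-- The summand of the finite quintuple product identity that is symmetric under `n ↦ -n`. -/
noncomputable def evenTerm (q z : S) (a s : ℕ) : S :=
  q ^ (3 * a.choose 2 + a) * z ^ (a + s) * (z * q ^ a - 1) * symNum q z s *
    gauss q (2 * s) (s + a) * invPoch (z ^ 2) q (s + a) * invPochRev (z ^ 2) q (s - a)

/-- The boundary term left by telescoping the partial sums of `evenTerm` in the level `s`. -/
noncomputable def evenBoundary (q z : S) (a s : ℕ) : S :=
  q ^ (s + 1 + 3 * a.choose 2) * z ^ (a + s) * symNum q z s *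
    invPoch (z ^ 2) q (s + a) * invPochRev (z ^ 2) q (s + 1 - a) *
    (gauss q (2 * s) (s + a) * (1 + z * q ^ (s + 1)) +
      gaussPred q (2 * s) (s + a) * (z ^ 2 + z * q ^ (2 * s + 2 - a)))

/-- The summand of the finite quintuple product identity that is symmetric under
`n ↦ -n - 1`. -/
noncomputable def oddTerm (q z : S) (b s : ℕ) : S :=
  q ^ (3 * b.choose 2 + 2 * b) * z ^ (b + s) * (1 - z ^ 2 * q ^ (2 * b + 1)) * symNum q z s *
    gauss q (2 * s + 1) (s + b + 1) * invPoch (z ^ 2) q (s + b + 1) *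
    invPochRev (z ^ 2) q (s - b)

/-- The boundary term left by telescoping the partial sums of `oddTerm` in the level `s`. -/
noncomputable def oddBoundary (q z : S) (b s : ℕ) : S :=
  q ^ (3 * b.choose 2 + b + s + 1) * z ^ (b + s) * (1 + z * q ^ b) * symNum q z s *
    invPoch (z ^ 2) q (s + b + 1) * invPochRev (z ^ 2) q (s + 1 - b) *
    (gauss q (2 * s + 1) (s + b + 1) * (1 + z * q ^ (s + 1)) +
      gauss q (2 * s + 1) (s + b) * (z ^ 2 + z * q ^ (2 * s + 2 - b)))

lemma choose_two_succ (a : ℕ) : (a + 1).choose 2 = a.choose 2 + a := by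
  rw [Nat.choose_succ_succ' a 1]; simp [add_comm]

variable {q z : S} (hq : ∀ n, IsUnit (1 - 1 * q ^ (n + 1)))
  (hz : ∀ n, IsUnit (1 - z ^ 2 * q ^ (n + 1))) (hw : ∀ n, IsUnit (z ^ 2 - q ^ (n + 1)))

include hq in
-- The common factor G is (q)_{i+j} / ((q)_{i+1} (q)_{j+1}). Its enlarged denominators make all
-- neighbouring binomials polynomial multiples of it, also at i = 0 or j = 0, so the telescoping
-- identities become polynomial identities.
lemma gauss_ratios (i j : ℕ) : ∃ G : S,
    gauss q (i + j) i = G * ((1 - q ^ (i + 1)) * (1 - q ^ (j + 1))) ∧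
    gauss q (i + j) (i + 1) = G * ((1 - q ^ j) * (1 - q ^ (j + 1))) ∧
    gaussPred q (i + j) i = G * ((1 - q ^ i) * (1 - q ^ (i + 1))) ∧
    gauss q (i + j + 2) (i + 1) = G * ((1 - q ^ (i + j + 1)) * (1 - q ^ (i + j + 2))) := by
  refine ⟨poch 1 q (i + j) * (invPoch 1 q (i + 1) * invPoch 1 q (j + 1)), ?_, ?_, ?_, ?_⟩
  · rw [gauss_eq q hq, invPoch_eq_mul 1 q i (hq i), invPoch_eq_mul 1 q j (hq j)]; ring
  · rcases j with _ | j
    · simp [gauss_eq_zero q (Nat.lt_succ_self i)]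
    · rw [show i + (j + 1) = (i + 1) + j by omega, gauss_eq q hq, invPoch_eq_mul 1 q j (hq j),
        invPoch_eq_mul 1 q (j + 1) (hq (j + 1))]; ring
  · rcases i with _ | i
    · simp [gaussPred]
    · rw [gaussPred, show (i + 1) + j = i + (j + 1) by omega, gauss_eq q hq,
        invPoch_eq_mul 1 q i (hq i), invPoch_eq_mul 1 q (i + 1) (hq (i + 1))]; ring
  · rw [show i + j + 2 = (i + 1) + (j + 1) by omega, gauss_eq q hq,
      show (i + 1) + (j + 1) = i + j + 1 + 1 by omega, poch_succ, poch_succ]; ring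

include hq hz hw in
-- Writing s = a + d removes the truncated subtractions. Once binomials and inverse products are
-- expressed through their common factors, a polynomial identity remains.
lemma evenBoundary_succ_sub_of_le (a d : ℕ) :
    evenBoundary q z (a + 1) (a + d) - evenBoundary q z a (a + d) =
      evenTerm q z a (a + d + 1) - evenTerm q z a (a + d) := by
  obtain ⟨G, h1, h2, h3, h4⟩ := gauss_ratios hq (2 * a + d) d
  unfold evenBoundary evenTerm
  rw [show a + d + 1 - (a + 1) = d by omega, show a + d + 1 - a = d + 1 by omega,
    show a + d - a = d by omega, show 2 * (a + d) + 2 - (a + 1) = a + 2 * d + 1 by omega,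
    show 2 * (a + d) + 2 - a = a + 2 * d + 2 by omega,
    show 2 * (a + d + 1) = 2 * a + d + d + 2 by omega, show 2 * (a + d) = 2 * a + d + d by omega,
    show a + d + (a + 1) = 2 * a + d + 1 by omega, show a + d + 1 + a = 2 * a + d + 1 by omega,
    show a + d + a = 2 * a + d by omega, choose_two_succ, symNum_succ,
    show gaussPred q (2 * a + d + d) (2 * a + d + 1) = gauss q (2 * a + d + d) (2 * a + d) from rfl,
    h1, h2, h3, h4, invPoch_eq_mul _ q _ (hz (2 * a + d)), invPochRev_eq_mul _ q _ (hw d)]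
  ring

lemma evenTerm_eq_zero {a s : ℕ} (h : s < a) : evenTerm q z a s = 0 := by
  rw [evenTerm, gauss_eq_zero q (by omega)]; ring

lemma evenBoundary_eq_zero {a s : ℕ} (h : s + 1 < a) : evenBoundary q z a s = 0 := by
  obtain ⟨k, hk⟩ : ∃ k, s + a = k + 1 := ⟨s + a - 1, by omega⟩
  rw [evenBoundary, hk, gaussPred, gauss_eq_zero q (by omega), gauss_eq_zero q (by omega)]; ring

include hz in
-- At this corner only the `gaussPred` part survives, and 1 - z² q^(2a+2) = (1 - z q^(a+1)) (1 + z
-- q^(a+1)) supplies the factors missing from the next level.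
lemma evenBoundary_succ_self (a : ℕ) :
    evenBoundary q z (a + 1) a = - evenTerm q z (a + 1) (a + 1) := by
  unfold evenBoundary evenTerm
  rw [show a + 1 - (a + 1) = 0 by omega, show 2 * a + 2 - (a + 1) = a + 1 by omega,
    show a + (a + 1) = 2 * a + 1 by omega, show 2 * (a + 1) = 2 * a + 2 by omega,
    show a + 1 + (a + 1) = 2 * a + 2 by omega,
    gaussPred, gauss_self, gauss_self, gauss_eq_zero q (Nat.lt_succ_self _), symNum_succ,
    show a + 1 + a = 2 * a + 1 by omega, invPoch_eq_mul _ q _ (hz (2 * a + 1))]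
  ring

include hq hz hw in
theorem evenBoundary_succ_sub (a s : ℕ) :
    evenBoundary q z (a + 1) s - evenBoundary q z a s =
      evenTerm q z a (s + 1) - evenTerm q z a s := by
  rcases le_or_gt a s with h | h
  · obtain ⟨d, rfl⟩ := Nat.exists_eq_add_of_le h
    exact evenBoundary_succ_sub_of_le hq hz hw a d
  rw [evenBoundary_eq_zero (show s + 1 < a + 1 by omega), evenTerm_eq_zero h]
  rcases Nat.lt_or_ge (s + 1) a with h' | h'
  · rw [evenBoundary_eq_zero h', evenTerm_eq_zero h']
  · obtain rfl : a = s + 1 := by omega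
    rw [evenBoundary_succ_self hz]; ring

include hq hz hw in
lemma oddBoundary_succ_sub_of_le (b d : ℕ) :
    oddBoundary q z (b + 1) (b + d) - oddBoundary q z b (b + d) =
      oddTerm q z b (b + d) - oddTerm q z b (b + d + 1) := by
  obtain ⟨G, h1, h2, h3, h4⟩ := gauss_ratios hq (2 * b + d + 1) d
  unfold oddBoundary oddTerm
  rw [show b + d + 1 - (b + 1) = d by omega, show b + d + 1 - b = d + 1 by omega,
    show b + d - b = d by omega, show 2 * (b + d) + 2 - (b + 1) = b + 2 * d + 1 by omega,
    show 2 * (b + d) + 2 - b = b + 2 * d + 2 by omega,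
    show 2 * (b + d + 1) + 1 = 2 * b + d + 1 + d + 2 by omega,
    show 2 * (b + d) + 1 = 2 * b + d + 1 + d by omega,
    show b + d + (b + 1) + 1 = 2 * b + d + 1 + 1 by omega,
    show b + d + (b + 1) = 2 * b + d + 1 by omega,
    show b + d + 1 + b + 1 = 2 * b + d + 1 + 1 by omega,
    show b + d + b + 1 = 2 * b + d + 1 by omega,
    show b + d + b = 2 * b + d by omega, choose_two_succ, symNum_succ,
    show gauss q (2 * b + d + 1 + d) (2 * b + d) = gaussPred q (2 * b + d + 1 + d) (2 * b + d + 1)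
      from rfl,
    h1, h2, h3, h4, invPoch_eq_mul _ q _ (hz (2 * b + d + 1)), invPochRev_eq_mul _ q _ (hw d)]
  ring

lemma oddTerm_eq_zero {b s : ℕ} (h : s < b) : oddTerm q z b s = 0 := by
  rw [oddTerm, gauss_eq_zero q (by omega)]; ring

lemma oddBoundary_eq_zero {b s : ℕ} (h : s + 1 < b) : oddBoundary q z b s = 0 := by
  rw [oddBoundary, gauss_eq_zero q (by omega), gauss_eq_zero q (by omega)]; ring

include hz in
lemma oddBoundary_succ_self (b : ℕ) :
    oddBoundary q z (b + 1) b = oddTerm q z (b + 1) (b + 1) := by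
  unfold oddBoundary oddTerm
  rw [show b + 1 - (b + 1) = 0 by omega, show 2 * b + 2 - (b + 1) = b + 1 by omega,
    show b + (b + 1) + 1 = 2 * b + 2 by omega, show b + (b + 1) = 2 * b + 1 by omega,
    show 2 * (b + 1) + 1 = 2 * b + 3 by omega,
    show b + 1 + (b + 1) + 1 = 2 * b + 3 by omega,
    gauss_self, gauss_self, gauss_eq_zero q (Nat.lt_succ_self _), symNum_succ,
    invPoch_eq_mul _ q _ (hz (2 * b + 2))]
  ring

include hq hz hw in
theorem oddBoundary_succ_sub (b s : ℕ) :
    oddBoundary q z (b + 1) s - oddBoundary q z b s =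
      oddTerm q z b s - oddTerm q z b (s + 1) := by
  rcases le_or_gt b s with h | h
  · obtain ⟨d, rfl⟩ := Nat.exists_eq_add_of_le h
    exact oddBoundary_succ_sub_of_le hq hz hw b d
  rw [oddBoundary_eq_zero (show s + 1 < b + 1 by omega), oddTerm_eq_zero h]
  rcases Nat.lt_or_ge (s + 1) b with h' | h'
  · rw [oddBoundary_eq_zero h', oddTerm_eq_zero h']
  · obtain rfl : b = s + 1 := by omega
    rw [oddBoundary_succ_self hz]

end Generic

/-! ### First-order expansion at z = 1 and the symmetry z ↦ z⁻¹ -/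

section Dual

variable {R : Type*} [CommRing R]

/-- The dual number `1 + ε`. -/
def onePlusEps (R : Type*) [CommRing R] : DualNumber R := 1 + DualNumber.eps

/-- The dual number `1 - ε`, inverse to `1 + ε`. -/
def oneSubEps (R : Type*) [CommRing R] : DualNumber R := 1 - DualNumber.eps

local notation "ζ" => onePlusEps R
local notation "ω" => oneSubEps R

/-- For `F = f (1 + ε)`, the value at `z = 1` of `(f z - z⁻¹ f z⁻¹) / (1 - z⁻¹)`. -/
def antisymValue : DualNumber R →+ R where
  toFun F := F.fst + 2 * F.snd
  map_zero' := by simp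
  map_add' F G := by simp; ring

lemma antisymValue_apply (F : DualNumber R) : antisymValue F = F.fst + 2 * F.snd := rfl

lemma antisymValue_inl_mul (r : R) (F : DualNumber R) :
    antisymValue (TrivSqZeroExt.inl r * F) = r * antisymValue F := by
  simp [antisymValue_apply]; ring

lemma fst_onePlusEps : (ζ).fst = 1 := by simp [onePlusEps]
lemma snd_onePlusEps : (ζ).snd = 1 := by simp [onePlusEps]
lemma fst_oneSubEps : (ω).fst = 1 := by simp [oneSubEps]
lemma snd_oneSubEps : (ω).snd = -1 := by simp [oneSubEps]

lemma oneSubEps_mul_onePlusEps : ω * ζ = 1 := by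
  ext <;> simp [fst_onePlusEps, snd_onePlusEps, fst_oneSubEps, snd_oneSubEps]

lemma isUnit_dual {x : DualNumber R} (h : IsUnit x.fst) : IsUnit x :=
  TrivSqZeroExt.isUnit_iff_isUnit_fst.mpr h

lemma map_gauss {S T : Type*} [CommRing S] [CommRing T] (f : S →+* T) (q : S) (n k : ℕ) :
    gauss (f q) n k = f (gauss q n k) := by
  induction n generalizing k with
  | zero => cases k <;> simp [gauss]
  | succ n ih => cases k <;> simp [gauss, ih]

lemma gauss_inl (Q : R) (n k : ℕ) :
    gauss (TrivSqZeroExt.inl Q : DualNumber R) n k = TrivSqZeroExt.inl (gauss Q n k) :=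
  map_gauss (TrivSqZeroExt.inlHom R R) Q n k

/-- Since z + z⁻¹ has no first-order term at z = 1, each (1 + z Q^i)(z + Q^i) z⁻¹ is free of ε. -/
lemma symNum_dual (Q : R) (n : ℕ) :
    symNum (TrivSqZeroExt.inl Q) ζ n = ζ ^ n * TrivSqZeroExt.inl (poch (-1) Q n ^ 2) := by
  induction n with
  | zero => simp [symNum, poch]
  | succ n ih =>
    rw [symNum_succ, ih, poch_succ]
    have : (1 + ζ * (TrivSqZeroExt.inl Q) ^ (n + 1)) * (ζ + (TrivSqZeroExt.inl Q) ^ (n + 1)) =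
        ζ * TrivSqZeroExt.inl ((1 - (-1) * Q ^ (n + 1)) ^ 2) := by
      rw [← TrivSqZeroExt.inl_pow]
      ext
      · simp [fst_onePlusEps]; ring
      · simp [fst_onePlusEps, snd_onePlusEps]; ring
    rw [this, mul_pow, TrivSqZeroExt.inl_mul]
    ring

variable {Q : R} (hQ : ∀ n, IsUnit (1 - 1 * Q ^ (n + 1)))

include hQ

lemma isUnit_one_sub_inl (n : ℕ) :
    IsUnit (1 - 1 * (TrivSqZeroExt.inl Q : DualNumber R) ^ (n + 1)) :=
  isUnit_dual (by simpa using hQ n)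

lemma isUnit_one_sub_sq_mul (n : ℕ) :
    IsUnit (1 - ζ ^ 2 * (TrivSqZeroExt.inl Q : DualNumber R) ^ (n + 1)) :=
  isUnit_dual (by simpa [fst_onePlusEps] using hQ n)

lemma isUnit_sq_sub (n : ℕ) :
    IsUnit (ζ ^ 2 - (TrivSqZeroExt.inl Q : DualNumber R) ^ (n + 1)) :=
  isUnit_dual (by simpa [fst_onePlusEps] using hQ n)

lemma inverse_mul_inverse_mul_sq (n : ℕ) :
    Ring.inverse (1 - ζ ^ 2 * (TrivSqZeroExt.inl Q : DualNumber R) ^ (n + 1)) *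
      Ring.inverse (ζ ^ 2 - (TrivSqZeroExt.inl Q : DualNumber R) ^ (n + 1)) * ζ ^ 2 =
      TrivSqZeroExt.inl (Ring.inverse (1 - 1 * Q ^ (n + 1)) ^ 2) := by
  have h1 := Ring.mul_inverse_cancel _ (isUnit_one_sub_sq_mul hQ n)
  have h2 := Ring.mul_inverse_cancel _ (isUnit_sq_sub hQ n)
  have h3 := Ring.mul_inverse_cancel _ (hQ n)
  have h4 : (1 - ζ ^ 2 * (TrivSqZeroExt.inl Q : DualNumber R) ^ (n + 1)) *
      (ζ ^ 2 - (TrivSqZeroExt.inl Q : DualNumber R) ^ (n + 1)) =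
      ζ ^ 2 * TrivSqZeroExt.inl ((1 - 1 * Q ^ (n + 1)) ^ 2) := by
    rw [← TrivSqZeroExt.inl_pow]
    ext
    · simp [fst_onePlusEps]; ring
    · simp [fst_onePlusEps, snd_onePlusEps]; ring
  have h5 : (TrivSqZeroExt.inl ((1 - 1 * Q ^ (n + 1)) ^ 2) : DualNumber R) *
      TrivSqZeroExt.inl (Ring.inverse (1 - 1 * Q ^ (n + 1)) ^ 2) = 1 := by
    rw [← TrivSqZeroExt.inl_mul, ← mul_pow, h3]; simp
  generalize Ring.inverse (1 - ζ ^ 2 * (TrivSqZeroExt.inl Q : DualNumber R) ^ (n + 1)) = u at *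
  generalize Ring.inverse (ζ ^ 2 - (TrivSqZeroExt.inl Q : DualNumber R) ^ (n + 1)) = v at *
  generalize (TrivSqZeroExt.inl (Ring.inverse (1 - 1 * Q ^ (n + 1)) ^ 2) : DualNumber R) = c at *
  generalize (TrivSqZeroExt.inl ((1 - 1 * Q ^ (n + 1)) ^ 2) : DualNumber R) = e at *
  generalize (1 - ζ ^ 2 * (TrivSqZeroExt.inl Q : DualNumber R) ^ (n + 1)) = x at *
  generalize (ζ ^ 2 - (TrivSqZeroExt.inl Q : DualNumber R) ^ (n + 1)) = y at *
  linear_combination (-u * v * ζ ^ 2) * h5 - c * u * v * h4 + c * y * v * h1 + c * h2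

lemma invPoch_mul_invPochRev (n : ℕ) :
    invPoch (ζ ^ 2) (TrivSqZeroExt.inl Q) n * invPochRev (ζ ^ 2) (TrivSqZeroExt.inl Q) n *
      ζ ^ (2 * n) = TrivSqZeroExt.inl (invPoch 1 Q n ^ 2) := by
  induction n with
  | zero => simp [invPoch, invPochRev]
  | succ n ih =>
    have h := inverse_mul_inverse_mul_sq hQ n
    simp only [invPoch, invPochRev, Finset.prod_range_succ, mul_pow] at ih ⊢
    rw [TrivSqZeroExt.inl_mul, ← ih, ← h]
    ring

/-- All factors symmetric under z ↦ z⁻¹ become scalars; ε survives only in a power of z, with `ω` in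
the role of z⁻¹. -/
lemma symNum_mul_invPoch_mul_invPochRev (s n : ℕ) :
    symNum (TrivSqZeroExt.inl Q) ζ s * (invPoch (ζ ^ 2) (TrivSqZeroExt.inl Q) n *
      invPochRev (ζ ^ 2) (TrivSqZeroExt.inl Q) n) =
    TrivSqZeroExt.inl (poch (-1) Q s ^ 2 * invPoch 1 Q n ^ 2) * (ζ ^ s * ω ^ (2 * n)) := by
  rw [TrivSqZeroExt.inl_mul, ← invPoch_mul_invPochRev hQ n, symNum_dual]
  have h : (ω * ζ) ^ (2 * n) = 1 := by rw [oneSubEps_mul_onePlusEps, one_pow]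
  rw [mul_pow] at h
  linear_combination (- ζ ^ s * TrivSqZeroExt.inl (poch (-1) Q s ^ 2) *
    (invPoch (ζ ^ 2) (TrivSqZeroExt.inl Q) n * invPochRev (ζ ^ 2) (TrivSqZeroExt.inl Q) n)) * h

/-- The index 0 is its own mirror image, and the boundaries on its two sides cancel. -/
lemma antisymValue_evenBoundary_zero_add_one (s : ℕ) :
    antisymValue (ω * evenBoundary (TrivSqZeroExt.inl Q) ζ 0 s) +
      antisymValue (ω * evenBoundary (TrivSqZeroExt.inl Q) ζ 1 s) = 0 := by
  obtain ⟨G, h1, h2, h3, -⟩ := gauss_ratios hQ s s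
  have hpred : gaussPred (TrivSqZeroExt.inl Q : DualNumber R) (2 * s) s =
      TrivSqZeroExt.inl (gauss Q (2 * s) (s + 1)) := by
    obtain ⟨G', -, h2', h3', -⟩ := gauss_ratios (isUnit_one_sub_inl hQ) s s
    rw [two_mul, h3', ← h2', gauss_inl]
  rw [← map_add]
  have key : ω * evenBoundary (TrivSqZeroExt.inl Q) ζ 0 s +
      ω * evenBoundary (TrivSqZeroExt.inl Q) ζ 1 s =
      TrivSqZeroExt.inl (Q ^ (s + 1) * (poch (-1) Q s ^ 2 * invPoch 1 Q (s + 1) ^ 2)) *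
      (ω ^ 3 * ((1 - ζ ^ 2 * TrivSqZeroExt.inl Q ^ (s + 1)) *
          (TrivSqZeroExt.inl (gauss Q (s + s) s) * (1 + ζ * TrivSqZeroExt.inl Q ^ (s + 1)) +
           TrivSqZeroExt.inl (gauss Q (s + s) (s + 1)) *
            (ζ ^ 2 + ζ * TrivSqZeroExt.inl Q ^ (2 * s + 2))) +
        ζ * (ζ ^ 2 - TrivSqZeroExt.inl Q ^ (s + 1)) *
          (TrivSqZeroExt.inl (gauss Q (s + s) (s + 1)) * (1 + ζ * TrivSqZeroExt.inl Q ^ (s + 1)) +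
           TrivSqZeroExt.inl (gauss Q (s + s) s) *
            (ζ ^ 2 + ζ * TrivSqZeroExt.inl Q ^ (2 * s + 1))))) := by
    have h := symNum_mul_invPoch_mul_invPochRev hQ s (s + 1)
    have hs : (ω * ζ) ^ (2 * s) = 1 := by rw [oneSubEps_mul_onePlusEps, one_pow]
    rw [evenBoundary, evenBoundary, add_zero, hpred,
      show gaussPred (TrivSqZeroExt.inl Q : DualNumber R) (2 * s) (s + 1) =
        gauss (TrivSqZeroExt.inl Q) (2 * s) s from rfl, gauss_inl, gauss_inl,
      show s + 1 - 0 = s + 1 by omega, show s + 1 - 1 = s by omega,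
      show 2 * s + 2 - 0 = 2 * s + 2 by omega, show 2 * s + 2 - 1 = 2 * s + 1 by omega,
      invPoch_eq_mul _ _ _ (isUnit_one_sub_sq_mul hQ s),
      invPochRev_eq_mul _ _ _ (isUnit_sq_sub hQ s), TrivSqZeroExt.inl_mul, ← two_mul,
      ← TrivSqZeroExt.inl_pow _ (s + 1), show (0 : ℕ).choose 2 = 0 from rfl,
      show (1 : ℕ).choose 2 = 0 from rfl]
    rw [mul_pow] at hs
    generalize (1 - ζ ^ 2 * TrivSqZeroExt.inl Q ^ (s + 1)) = x at *
    generalize (ζ ^ 2 - TrivSqZeroExt.inl Q ^ (s + 1)) = y at *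
    generalize (TrivSqZeroExt.inl (gauss Q (2 * s) s) : DualNumber R) = g at *
    generalize (TrivSqZeroExt.inl (gauss Q (2 * s) (s + 1)) : DualNumber R) = g' at *
    generalize symNum (TrivSqZeroExt.inl Q) ζ s = N at *
    generalize invPoch (ζ ^ 2) (TrivSqZeroExt.inl Q) (s + 1) = r at *
    generalize invPochRev (ζ ^ 2) (TrivSqZeroExt.inl Q) (s + 1) = r' at *
    generalize (TrivSqZeroExt.inl (poch (-1) Q s ^ 2 * invPoch 1 Q (s + 1) ^ 2)
      : DualNumber R) = c at *
    generalize (TrivSqZeroExt.inl Q : DualNumber R) = q at *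
    linear_combination (ω * q ^ (s + 1) * ζ ^ s * (x * (g * (1 + ζ * q ^ (s + 1)) +
      g' * (ζ ^ 2 + ζ * q ^ (2 * s + 2))) + ζ * y * (g' * (1 + ζ * q ^ (s + 1)) +
      g * (ζ ^ 2 + ζ * q ^ (2 * s + 1))))) * h + (c * ω ^ 3 * q ^ (s + 1) *
      (x * (g * (1 + ζ * q ^ (s + 1)) +
      g' * (ζ ^ 2 + ζ * q ^ (2 * s + 2))) + ζ * y * (g' * (1 + ζ * q ^ (s + 1)) +
      g * (ζ ^ 2 + ζ * q ^ (2 * s + 1))))) * hs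
  rw [key, antisymValue_inl_mul, h1, h2]
  simp only [TrivSqZeroExt.inl_pow]
  -- With t = Q^s, y = Q^(s+1), u = [2s, s] and v = [2s, s+1], the last factor vanishes because v (1
  -- - Q^(s+1)) = u (1 - Q^s).
  have : ∀ t y u v : R, antisymValue (ω ^ 3 * ((1 - ζ ^ 2 * TrivSqZeroExt.inl y) *
          (TrivSqZeroExt.inl u * (1 + ζ * TrivSqZeroExt.inl y) +
           TrivSqZeroExt.inl v * (ζ ^ 2 + ζ * TrivSqZeroExt.inl (y * y))) +
        ζ * (ζ ^ 2 - TrivSqZeroExt.inl y) *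
          (TrivSqZeroExt.inl v * (1 + ζ * TrivSqZeroExt.inl y) +
           TrivSqZeroExt.inl u * (ζ ^ 2 + ζ * TrivSqZeroExt.inl (t * y))))) =
          y * (3 + y) * (v * (1 - y) - u * (1 - t)) := by
    intro t y u v
    simp [antisymValue_apply, fst_onePlusEps, snd_onePlusEps, fst_oneSubEps, snd_oneSubEps]
    ring
  have h4 := this (Q ^ s) (Q ^ (s + 1)) (G * ((1 - Q ^ (s + 1)) * (1 - Q ^ (s + 1))))
    (G * ((1 - Q ^ s) * (1 - Q ^ (s + 1))))
  rw [← pow_add, ← pow_add, show s + 1 + (s + 1) = 2 * s + 2 by omega,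
    show s + (s + 1) = 2 * s + 1 by omega] at h4
  rw [h4]
  ring

/-- Up to scalars the boundary is f(z) = z⁻² (1 + z)(1 + c z + z²), which satisfies f(z) = z⁻¹
f(z⁻¹). -/
lemma antisymValue_oddBoundary_zero (s : ℕ) :
    antisymValue (oddBoundary (TrivSqZeroExt.inl Q) ζ 0 s) = 0 := by
  have hg : gauss (TrivSqZeroExt.inl Q : DualNumber R) (2 * s + 1) s =
      TrivSqZeroExt.inl (gauss Q (2 * s + 1) (s + 1)) := by
    obtain ⟨G', h1', -, h3', -⟩ := gauss_ratios (isUnit_one_sub_inl hQ) (s + 1) s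
    rw [gaussPred, mul_comm (1 - _), ← h1', show s + 1 + s = 2 * s + 1 by omega] at h3'
    rw [h3', gauss_inl]
  have h := symNum_mul_invPoch_mul_invPochRev hQ s (s + 1)
  have key : oddBoundary (TrivSqZeroExt.inl Q) ζ 0 s =
      TrivSqZeroExt.inl (Q ^ (s + 1) * gauss Q (2 * s + 1) (s + 1) *
        (poch (-1) Q s ^ 2 * invPoch 1 Q (s + 1) ^ 2)) *
      (ω ^ 2 * ((1 + ζ) * (1 + ζ * TrivSqZeroExt.inl Q ^ (s + 1) +
        (ζ ^ 2 + ζ * TrivSqZeroExt.inl Q ^ (2 * s + 2))))) := by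
    have hs : (ω * ζ) ^ (2 * s) = 1 := by rw [oneSubEps_mul_onePlusEps, one_pow]
    rw [mul_pow] at hs
    rw [oddBoundary, add_zero, add_zero, hg, gauss_inl, show s + 1 - 0 = s + 1 by omega,
      show 2 * s + 2 - 0 = 2 * s + 2 by omega, show (0 : ℕ).choose 2 = 0 from rfl,
      TrivSqZeroExt.inl_mul, TrivSqZeroExt.inl_mul, ← TrivSqZeroExt.inl_pow]
    generalize (TrivSqZeroExt.inl (gauss Q (2 * s + 1) (s + 1)) : DualNumber R) = g at *
    generalize symNum (TrivSqZeroExt.inl Q) ζ s = N at *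
    generalize invPoch (ζ ^ 2) (TrivSqZeroExt.inl Q) (s + 1) = r at *
    generalize invPochRev (ζ ^ 2) (TrivSqZeroExt.inl Q) (s + 1) = r' at *
    generalize (TrivSqZeroExt.inl (poch (-1) Q s ^ 2 * invPoch 1 Q (s + 1) ^ 2)
      : DualNumber R) = c at *
    generalize (TrivSqZeroExt.inl Q : DualNumber R) = q at *
    linear_combination (q ^ (s + 1) * ζ ^ s * (1 + ζ) * g * (1 + ζ * q ^ (s + 1) +
      (ζ ^ 2 + ζ * q ^ (2 * s + 2)))) * h + (c * ω ^ 2 * q ^ (s + 1) * (1 + ζ) * g *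
      (1 + ζ * q ^ (s + 1) + (ζ ^ 2 + ζ * q ^ (2 * s + 2)))) * hs
  rw [key, antisymValue_inl_mul]
  simp only [TrivSqZeroExt.inl_pow]
  have : ∀ x y : R, antisymValue (ω ^ 2 * ((1 + ζ) * (1 + ζ * TrivSqZeroExt.inl x +
        (ζ ^ 2 + ζ * TrivSqZeroExt.inl y)))) = 0 := by
    intro x y
    simp [antisymValue_apply, fst_onePlusEps, snd_onePlusEps, fst_oneSubEps, snd_oneSubEps]
    ring
  rw [this, mul_zero]

/-- The self-paired index 0 counts the term n = 0 twice, hence the doubling of the others. One level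
adds twice the boundary at A + 1 minus the boundaries at 0 and 1, and these two cancel. -/
theorem antisymValue_evenTerm_sum (A m : ℕ) :
    antisymValue (ω * evenTerm (TrivSqZeroExt.inl Q) ζ 0 m) +
      2 * ∑ a ∈ Finset.range A, antisymValue (ω * evenTerm (TrivSqZeroExt.inl Q) ζ (a + 1) m) =
    2 + 2 * ∑ s ∈ Finset.range m,
      antisymValue (ω * evenBoundary (TrivSqZeroExt.inl Q) ζ (A + 1) s) := by
  induction m with
  | zero =>
    simp [evenTerm, gauss, symNum, invPoch, invPochRev, antisymValue_apply,
      fst_onePlusEps, snd_onePlusEps, fst_oneSubEps]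
  | succ m ih =>
    have step : ∀ a, antisymValue (ω * evenTerm (TrivSqZeroExt.inl Q) ζ a (m + 1)) =
        antisymValue (ω * evenTerm (TrivSqZeroExt.inl Q) ζ a m) +
        (antisymValue (ω * evenBoundary (TrivSqZeroExt.inl Q) ζ (a + 1) m) -
          antisymValue (ω * evenBoundary (TrivSqZeroExt.inl Q) ζ a m)) := by
      intro a
      rw [← map_sub, ← map_add]
      congr 1
      linear_combination (-ω) * evenBoundary_succ_sub (isUnit_one_sub_inl hQ)
        (isUnit_one_sub_sq_mul hQ) (isUnit_sq_sub hQ) a m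
    simp_rw [step]
    rw [Finset.sum_add_distrib, Finset.sum_range_sub
      (fun a => antisymValue (ω * evenBoundary (TrivSqZeroExt.inl Q) ζ (a + 1) m)),
      Finset.sum_range_succ]
    linear_combination ih - antisymValue_evenBoundary_zero_add_one hQ m

theorem antisymValue_oddTerm_sum (B m : ℕ) :
    ∑ b ∈ Finset.range (B + 1), antisymValue (oddTerm (TrivSqZeroExt.inl Q) ζ b m) =
    1 - ∑ s ∈ Finset.range m, antisymValue (oddBoundary (TrivSqZeroExt.inl Q) ζ (B + 1) s) := by
  induction m with
  | zero =>
    have h : ∀ a, antisymValue (oddTerm (TrivSqZeroExt.inl Q) ζ (a + 1) 0) = 0 := by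
      intro a; rw [oddTerm_eq_zero (Nat.succ_pos a)]; simp
    have h0 := Ring.mul_inverse_cancel _ (isUnit_one_sub_sq_mul hQ 0)
    simp only [zero_add, pow_one] at h0
    have h1 : oddTerm (TrivSqZeroExt.inl Q) ζ 0 0 = 1 := by
      simpa [oddTerm, gauss, symNum, invPoch, invPochRev] using h0
    rw [Finset.sum_range_succ', Finset.sum_eq_zero fun a _ => h a, h1]
    simp [antisymValue_apply]
  | succ m ih =>
    have step : ∀ a, antisymValue (oddTerm (TrivSqZeroExt.inl Q) ζ a (m + 1)) =
        antisymValue (oddTerm (TrivSqZeroExt.inl Q) ζ a m) -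
        (antisymValue (oddBoundary (TrivSqZeroExt.inl Q) ζ (a + 1) m) -
          antisymValue (oddBoundary (TrivSqZeroExt.inl Q) ζ a m)) := by
      intro a
      rw [← map_sub, ← map_sub]
      congr 1
      linear_combination oddBoundary_succ_sub (isUnit_one_sub_inl hQ)
        (isUnit_one_sub_sq_mul hQ) (isUnit_sq_sub hQ) a m
    simp_rw [step]
    rw [Finset.sum_sub_distrib, Finset.sum_range_sub
      (fun a => antisymValue (oddBoundary (TrivSqZeroExt.inl Q) ζ a m)),
      Finset.sum_range_succ _ m, antisymValue_oddBoundary_zero hQ, ih]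
    ring

end Dual

/-! ### Non-negativity of the boundary terms -/

section Nonneg

/-- The power series with non-negative coefficients. -/
def nonnegSeries : Subsemiring ℚ⟦X⟧ where
  carrier := {f | ∀ k, 0 ≤ coeff k f}
  mul_mem' {f g} hf hg k := by
    rw [coeff_mul]
    exact Finset.sum_nonneg fun p _ => mul_nonneg (hf p.1) (hg p.2)
  one_mem' k := by rw [coeff_one]; split_ifs <;> norm_num
  add_mem' {f g} hf hg k := by rw [map_add]; exact add_nonneg (hf k) (hg k)
  zero_mem' k := by simp

/-- The dual numbers both of whose components have non-negative coefficients. -/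
def nonnegDual : Subsemiring (DualNumber ℚ⟦X⟧) where
  carrier := {F | F.fst ∈ nonnegSeries ∧ F.snd ∈ nonnegSeries}
  mul_mem' {F G} hF hG := by
    refine ⟨?_, ?_⟩
    · rw [TrivSqZeroExt.fst_mul]; exact mul_mem hF.1 hG.1
    · rw [TrivSqZeroExt.snd_mul]
      exact add_mem (mul_mem hF.1 hG.2) (mul_mem hF.2 hG.1)
  one_mem' := ⟨by simp [one_mem], by simp [zero_mem]⟩
  add_mem' {F G} hF hG := ⟨by simpa using add_mem hF.1 hG.1, by simpa using add_mem hF.2 hG.2⟩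
  zero_mem' := ⟨by simp [zero_mem], by simp [zero_mem]⟩

lemma antisymValue_mem {F : DualNumber ℚ⟦X⟧} (hF : F ∈ nonnegDual) :
    antisymValue F ∈ nonnegSeries := by
  rw [antisymValue_apply, two_mul]
  exact add_mem hF.1 (add_mem hF.2 hF.2)

lemma inl_mem_nonnegDual {f : ℚ⟦X⟧} (hf : f ∈ nonnegSeries) :
    (TrivSqZeroExt.inl f : DualNumber ℚ⟦X⟧) ∈ nonnegDual :=
  ⟨by simpa using hf, by simp [zero_mem]⟩

lemma X_mem_nonnegSeries : (X : ℚ⟦X⟧) ∈ nonnegSeries := by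
  intro k; rw [coeff_X]; split_ifs <;> norm_num

lemma onePlusEps_mem : onePlusEps ℚ⟦X⟧ ∈ nonnegDual :=
  ⟨by rw [fst_onePlusEps]; exact one_mem _, by rw [snd_onePlusEps]; exact one_mem _⟩

lemma isUnit_one_sub_X_sq (n : ℕ) : IsUnit (1 - 1 * ((X : ℚ⟦X⟧) ^ 2) ^ (n + 1)) := by
  rw [PowerSeries.isUnit_iff_constantCoeff]
  simp

/-- The equation f = 1 + f Y is a recursion for the coefficients with non-negative weights. -/
lemma mem_nonnegSeries_of_mul_one_sub {f Y : ℚ⟦X⟧} (hY : Y ∈ nonnegSeries)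
    (h0 : constantCoeff Y = 0) (h : f * (1 - Y) = 1) : f ∈ nonnegSeries := by
  have hf : f = 1 + f * Y := by linear_combination h
  intro k
  induction k using Nat.strong_induction_on with
  | _ k ih =>
    rw [hf, map_add, coeff_mul]
    refine add_nonneg ((one_mem nonnegSeries : _) k) (Finset.sum_nonneg fun p hp => ?_)
    rw [Finset.HasAntidiagonal.mem_antidiagonal] at hp
    rcases Nat.eq_zero_or_pos p.2 with h2 | h2
    · rw [h2, coeff_zero_eq_constantCoeff_apply, h0, mul_zero]
    · exact mul_nonneg (ih _ (by omega)) (hY _)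

lemma inverse_one_sub_mem (n : ℕ) :
    Ring.inverse (1 - 1 * ((X : ℚ⟦X⟧) ^ 2) ^ (n + 1)) ∈ nonnegSeries := by
  refine mem_nonnegSeries_of_mul_one_sub (Y := 1 * (X ^ 2) ^ (n + 1)) ?_ (by simp)
    (Ring.inverse_mul_cancel _ (isUnit_one_sub_X_sq n))
  rw [one_mul]
  exact pow_mem (pow_mem X_mem_nonnegSeries _) _

lemma invPoch_one_mem (n : ℕ) : invPoch 1 ((X : ℚ⟦X⟧) ^ 2) n ∈ nonnegSeries :=
  prod_mem fun i _ => inverse_one_sub_mem i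

lemma poch_neg_one_mem (n : ℕ) : poch (-1) ((X : ℚ⟦X⟧) ^ 2) n ∈ nonnegSeries := by
  refine prod_mem fun i _ => ?_
  rw [neg_one_mul, sub_neg_eq_add]
  exact add_mem (one_mem _) (pow_mem (pow_mem X_mem_nonnegSeries _) _)

lemma gauss_mem (n k : ℕ) : gauss ((X : ℚ⟦X⟧) ^ 2) n k ∈ nonnegSeries := by
  induction n generalizing k with
  | zero => cases k with
    | zero => exact one_mem _
    | succ k => exact zero_mem _
  | succ n ih => cases k with
    | zero => exact one_mem _
    | succ k =>
      exact add_mem (ih k) (mul_mem (pow_mem (pow_mem X_mem_nonnegSeries _) _) (ih (k + 1)))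

local notation "ζ" => onePlusEps ℚ⟦X⟧
local notation "ω" => oneSubEps ℚ⟦X⟧
local notation "𝔮" => (TrivSqZeroExt.inl ((X : ℚ⟦X⟧) ^ 2) : DualNumber ℚ⟦X⟧)

lemma inl_X_sq_mem : 𝔮 ∈ nonnegDual := inl_mem_nonnegDual (pow_mem X_mem_nonnegSeries _)

/-- To first order, (1 - z² y)⁻¹ = c + 2 y c² ε with y = Q^(n+1) and c = (1 - y)⁻¹. -/
lemma inverse_one_sub_sq_mul_mem (n : ℕ) :
    Ring.inverse (1 - ζ ^ 2 * 𝔮 ^ (n + 1)) ∈ nonnegDual := by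
  set c := Ring.inverse (1 - 1 * ((X : ℚ⟦X⟧) ^ 2) ^ (n + 1)) with hc
  have h : (1 - ζ ^ 2 * 𝔮 ^ (n + 1)) * (TrivSqZeroExt.inl c +
      TrivSqZeroExt.inl ((1 + 1) * (X ^ 2) ^ (n + 1) * c ^ 2) * DualNumber.eps) = 1 := by
    have h1 : (1 - 1 * ((X : ℚ⟦X⟧) ^ 2) ^ (n + 1)) * c = 1 :=
      Ring.mul_inverse_cancel _ (isUnit_one_sub_X_sq n)
    rw [TrivSqZeroExt.inl_pow]
    ext1
    · simp [fst_onePlusEps] at h1 ⊢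
      exact h1
    · simp [fst_onePlusEps, snd_onePlusEps] at h1 ⊢
      linear_combination 2 * (X ^ 2) ^ (n + 1) * c * h1
  have h2 : Ring.inverse (1 - ζ ^ 2 * 𝔮 ^ (n + 1)) = TrivSqZeroExt.inl c +
      TrivSqZeroExt.inl ((1 + 1) * (X ^ 2) ^ (n + 1) * c ^ 2) * DualNumber.eps :=
    (isUnit_one_sub_sq_mul isUnit_one_sub_X_sq n).mul_left_cancel
      ((Ring.mul_inverse_cancel _ (isUnit_one_sub_sq_mul isUnit_one_sub_X_sq n)).trans h.symm)
  rw [h2]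
  have hcm : c ∈ nonnegSeries := inverse_one_sub_mem n
  refine add_mem (inl_mem_nonnegDual hcm) (mul_mem (inl_mem_nonnegDual (mul_mem (mul_mem
    (add_mem (one_mem _) (one_mem _)) (pow_mem (pow_mem X_mem_nonnegSeries _) _))
    (pow_mem hcm _))) ⟨by simp [zero_mem], by simp [one_mem]⟩)

lemma invPoch_add {S : Type*} [CommRing S] (c q : S) (d r : ℕ) :
    invPoch c q (d + r) = invPoch c q d *
      ∏ i ∈ Finset.range r, Ring.inverse (1 - c * q ^ (d + i + 1)) :=
  Finset.prod_range_add _ _ _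

/-- The first d factors pair with the reversed ones into a scalar and a power of z⁻¹; the r unpaired
factors are non-negative as they stand. -/
lemma symNum_mul_invPoch_add (s d r : ℕ) :
    symNum 𝔮 ζ s * invPoch (ζ ^ 2) 𝔮 (d + r) * invPochRev (ζ ^ 2) 𝔮 d =
    TrivSqZeroExt.inl (poch (-1) (X ^ 2) s ^ 2 * invPoch 1 (X ^ 2) d ^ 2) *
      (ζ ^ s * ω ^ (2 * d)) *
      ∏ i ∈ Finset.range r, Ring.inverse (1 - ζ ^ 2 * 𝔮 ^ (d + i + 1)) := by
  rw [invPoch_add, ← symNum_mul_invPoch_mul_invPochRev isUnit_one_sub_X_sq]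
  ring

lemma oneSubEps_pow_mul_onePlusEps_pow (n : ℕ) : ω ^ n * ζ ^ n = 1 := by
  rw [← mul_pow, oneSubEps_mul_onePlusEps, one_pow]

lemma real_part_mem (s d : ℕ) : (TrivSqZeroExt.inl (poch (-1) ((X : ℚ⟦X⟧) ^ 2) s ^ 2 *
    invPoch 1 (X ^ 2) d ^ 2) : DualNumber ℚ⟦X⟧) ∈ nonnegDual :=
  inl_mem_nonnegDual (mul_mem (pow_mem (poch_neg_one_mem s) 2) (pow_mem (invPoch_one_mem d) 2))

lemma gauss_inl_mem (n k : ℕ) : gauss 𝔮 n k ∈ nonnegDual := by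
  rw [gauss_inl]; exact inl_mem_nonnegDual (gauss_mem n k)

lemma bracket_mem {G H : DualNumber ℚ⟦X⟧} (hG : G ∈ nonnegDual) (hH : H ∈ nonnegDual)
    (m n : ℕ) : G * (1 + ζ * 𝔮 ^ m) + H * (ζ ^ 2 + ζ * 𝔮 ^ n) ∈ nonnegDual :=
  add_mem
    (mul_mem hG (add_mem (one_mem _) (mul_mem onePlusEps_mem (pow_mem inl_X_sq_mem _))))
    (mul_mem hH (add_mem (pow_mem onePlusEps_mem _)
      (mul_mem onePlusEps_mem (pow_mem inl_X_sq_mem _))))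

/-- For s = A + d the powers of z add up to -1 + (2A+d+1) + (A+d) - 2d = 3A. No negative power
remains, and every other factor is non-negative to first order. -/
theorem evenBoundary_mem (A s : ℕ) : ω * evenBoundary 𝔮 ζ (A + 1) s ∈ nonnegDual := by
  rcases Nat.lt_or_ge s A with h | h
  · rw [evenBoundary_eq_zero (by omega), mul_zero]; exact zero_mem _
  obtain ⟨d, rfl⟩ := Nat.exists_eq_add_of_le h
  have h1 := symNum_mul_invPoch_add (A + d) d (2 * A + 1)
  have h2 := oneSubEps_pow_mul_onePlusEps_pow (2 * d + 1)
  have hp : (∏ i ∈ Finset.range (2 * A + 1), Ring.inverse (1 - ζ ^ 2 * 𝔮 ^ (d + i + 1))) ∈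
      nonnegDual := prod_mem fun i _ => inverse_one_sub_sq_mul_mem (d + i)
  have hB := bracket_mem (gauss_inl_mem (2 * (A + d)) (A + d + (A + 1)))
    (gauss_inl_mem (2 * (A + d)) (A + d + A)) (A + d + 1) (2 * (A + d) + 2 - (A + 1))
  have hE : ω * evenBoundary 𝔮 ζ (A + 1) (A + d) =
      𝔮 ^ (A + d + 1 + 3 * (A + 1).choose 2) * ζ ^ (3 * A) *
      TrivSqZeroExt.inl (poch (-1) (X ^ 2) (A + d) ^ 2 * invPoch 1 (X ^ 2) d ^ 2) *
      (∏ i ∈ Finset.range (2 * A + 1), Ring.inverse (1 - ζ ^ 2 * 𝔮 ^ (d + i + 1))) *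
      (gauss 𝔮 (2 * (A + d)) (A + d + (A + 1)) * (1 + ζ * 𝔮 ^ (A + d + 1)) +
        gauss 𝔮 (2 * (A + d)) (A + d + A) *
          (ζ ^ 2 + ζ * 𝔮 ^ (2 * (A + d) + 2 - (A + 1)))) := by
    rw [evenBoundary, show A + d + 1 - (A + 1) = d by omega,
      show gaussPred 𝔮 (2 * (A + d)) (A + d + (A + 1)) = gauss 𝔮 (2 * (A + d)) (A + d + A) from rfl]
    rw [show d + (2 * A + 1) = A + d + (A + 1) by omega] at h1
    generalize gauss 𝔮 (2 * (A + d)) (A + d + (A + 1)) * (1 + ζ * 𝔮 ^ (A + d + 1)) +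
        gauss 𝔮 (2 * (A + d)) (A + d + A) *
          (ζ ^ 2 + ζ * 𝔮 ^ (2 * (A + d) + 2 - (A + 1))) = B at *
    generalize ∏ i ∈ Finset.range (2 * A + 1), Ring.inverse (1 - ζ ^ 2 * 𝔮 ^ (d + i + 1)) = P at *
    generalize (TrivSqZeroExt.inl (poch (-1) (X ^ 2) (A + d) ^ 2 * invPoch 1 (X ^ 2) d ^ 2)
      : DualNumber ℚ⟦X⟧) = c at *
    linear_combination (ω * 𝔮 ^ (A + d + 1 + 3 * (A + 1).choose 2) * ζ ^ (2 * A + d + 1) * B) * h1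
      + 𝔮 ^ (A + d + 1 + 3 * (A + 1).choose 2) * ζ ^ (3 * A) * c * P * B * h2
  rw [hE]
  exact mul_mem (mul_mem (mul_mem (mul_mem (pow_mem inl_X_sq_mem _) (pow_mem onePlusEps_mem _))
    (real_part_mem _ _)) hp) hB

theorem oddBoundary_mem (A s : ℕ) : oddBoundary 𝔮 ζ (A + 1) s ∈ nonnegDual := by
  rcases Nat.lt_or_ge s A with h | h
  · rw [oddBoundary_eq_zero (by omega)]; exact zero_mem _
  obtain ⟨d, rfl⟩ := Nat.exists_eq_add_of_le h
  have h1 := symNum_mul_invPoch_add (A + d) d (2 * A + 2)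
  have h2 := oneSubEps_pow_mul_onePlusEps_pow (2 * d)
  have hp : (∏ i ∈ Finset.range (2 * A + 2), Ring.inverse (1 - ζ ^ 2 * 𝔮 ^ (d + i + 1))) ∈
      nonnegDual := prod_mem fun i _ => inverse_one_sub_sq_mul_mem (d + i)
  have hB := bracket_mem (gauss_inl_mem (2 * (A + d) + 1) (A + d + (A + 1) + 1))
    (gauss_inl_mem (2 * (A + d) + 1) (A + d + (A + 1))) (A + d + 1) (2 * (A + d) + 2 - (A + 1))
  have hE : oddBoundary 𝔮 ζ (A + 1) (A + d) =
      𝔮 ^ (3 * (A + 1).choose 2 + (A + 1) + (A + d) + 1) * ζ ^ (3 * A + 1) *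
      (1 + ζ * 𝔮 ^ (A + 1)) *
      TrivSqZeroExt.inl (poch (-1) (X ^ 2) (A + d) ^ 2 * invPoch 1 (X ^ 2) d ^ 2) *
      (∏ i ∈ Finset.range (2 * A + 2), Ring.inverse (1 - ζ ^ 2 * 𝔮 ^ (d + i + 1))) *
      (gauss 𝔮 (2 * (A + d) + 1) (A + d + (A + 1) + 1) * (1 + ζ * 𝔮 ^ (A + d + 1)) +
        gauss 𝔮 (2 * (A + d) + 1) (A + d + (A + 1)) *
          (ζ ^ 2 + ζ * 𝔮 ^ (2 * (A + d) + 2 - (A + 1)))) := by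
    rw [oddBoundary, show A + d + 1 - (A + 1) = d by omega]
    rw [show d + (2 * A + 2) = A + d + (A + 1) + 1 by omega] at h1
    generalize gauss 𝔮 (2 * (A + d) + 1) (A + d + (A + 1) + 1) * (1 + ζ * 𝔮 ^ (A + d + 1)) +
        gauss 𝔮 (2 * (A + d) + 1) (A + d + (A + 1)) *
          (ζ ^ 2 + ζ * 𝔮 ^ (2 * (A + d) + 2 - (A + 1))) = B at *
    generalize ∏ i ∈ Finset.range (2 * A + 2), Ring.inverse (1 - ζ ^ 2 * 𝔮 ^ (d + i + 1)) = P at *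
    generalize (TrivSqZeroExt.inl (poch (-1) (X ^ 2) (A + d) ^ 2 * invPoch 1 (X ^ 2) d ^ 2)
      : DualNumber ℚ⟦X⟧) = c at *
    linear_combination (𝔮 ^ (3 * (A + 1).choose 2 + (A + 1) + (A + d) + 1) * ζ ^ (2 * A + d + 1) *
      (1 + ζ * 𝔮 ^ (A + 1)) * B) * h1
      + 𝔮 ^ (3 * (A + 1).choose 2 + (A + 1) + (A + d) + 1) * (1 + ζ * 𝔮 ^ (A + 1)) *
        ζ ^ (3 * A + 1) * c * P * B * h2
  rw [hE]
  exact mul_mem (mul_mem (mul_mem (mul_mem (mul_mem (pow_mem inl_X_sq_mem _)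
    (pow_mem onePlusEps_mem _)) (add_mem (one_mem _) (mul_mem onePlusEps_mem
    (pow_mem inl_X_sq_mem _)))) (real_part_mem _ _)) hp) hB

end Nonneg

/-! ### Stabilisation modulo a power of q -/

section Truncation

variable {S T : Type*} [CommRing S] [CommRing T] (f : S →+* T) {q : S} {K : ℕ}

lemma map_pow_eq_zero_of_le (hK : f q ^ K = 0) {n : ℕ} (h : K ≤ n) : f (q ^ n) = 0 := by
  rw [map_pow]; exact pow_eq_zero_of_le h hK

lemma map_inverse_eq_one (hK : f q ^ K = 0) (c : S) {n : ℕ} (h : K ≤ n)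
    (hu : IsUnit (1 - c * q ^ n)) : f (Ring.inverse (1 - c * q ^ n)) = 1 := by
  have h1 := congrArg f (Ring.mul_inverse_cancel _ hu)
  rwa [map_mul, map_sub, map_mul, map_pow_eq_zero_of_le f hK h, map_one, mul_zero, sub_zero,
    one_mul] at h1

lemma map_poch_of_le (hK : f q ^ K = 0) (c : S) {n : ℕ} (h : K ≤ n) :
    f (poch c q n) = f (poch c q K) := by
  obtain ⟨r, rfl⟩ := Nat.exists_eq_add_of_le h
  rw [poch, Finset.prod_range_add, map_mul, ← poch, map_prod, Finset.prod_eq_one, mul_one]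
  intro i _
  rw [map_sub, map_mul, map_pow_eq_zero_of_le f hK (by omega), map_one, mul_zero, sub_zero]

lemma map_prod_inverse_eq_one (hK : f q ^ K = 0) (c : S) {d : ℕ} (h : K ≤ d)
    (hu : ∀ n, IsUnit (1 - c * q ^ (n + 1))) (r : ℕ) :
    f (∏ i ∈ Finset.range r, Ring.inverse (1 - c * q ^ (d + i + 1))) = 1 := by
  rw [map_prod, Finset.prod_eq_one]
  exact fun i _ => map_inverse_eq_one f hK c (by omega) (hu _)

lemma map_invPoch_of_le (hK : f q ^ K = 0) (c : S) {n : ℕ} (h : K ≤ n)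
    (hu : ∀ n, IsUnit (1 - c * q ^ (n + 1))) :
    f (invPoch c q n) = f (invPoch c q K) := by
  obtain ⟨r, rfl⟩ := Nat.exists_eq_add_of_le h
  rw [invPoch_add, map_mul, map_prod_inverse_eq_one f hK c le_rfl hu, mul_one]

lemma map_gauss_of_le (hK : f q ^ K = 0) (hu : ∀ n, IsUnit (1 - 1 * q ^ (n + 1))) {i j : ℕ}
    (hi : K ≤ i) (hj : K ≤ j) : f (gauss q (i + j) i) = f (invPoch 1 q K) := by
  rw [gauss_eq q hu, map_mul, map_mul, map_poch_of_le f hK 1 (by omega : K ≤ i + j),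
    map_invPoch_of_le f hK 1 hi hu, map_invPoch_of_le f hK 1 hj hu, ← mul_assoc, ← map_mul,
    poch_mul_invPoch 1 q hu, map_one, one_mul]

/-- The product `∏_{i < n} (1 - q^(2i+1))`. -/
def oddPoch (q : S) (n : ℕ) : S := ∏ i ∈ Finset.range n, (1 - q ^ (2 * i + 1))

/-- A finite form of Euler's (-q;q)_∞ (q;q²)_∞ = 1. It explains why `invProdTrunc` has a square of
(-q;q) in place of an inverse square of (q;q²). -/
lemma poch_mul_poch_neg_mul_oddPoch (q : S) (n : ℕ) :
    poch 1 q n * poch (-1) q n * oddPoch q n = poch 1 q (2 * n) := by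
  induction n with
  | zero => simp [poch, oddPoch]
  | succ n ih =>
    rw [show 2 * (n + 1) = 2 * n + 1 + 1 by omega, poch_succ, poch_succ, poch_succ, poch_succ,
      ← ih, oddPoch, oddPoch, Finset.prod_range_succ]
    ring

/-- A truncation of the inverse of the product side. -/
noncomputable def invProdTrunc (q : S) (K : ℕ) : S := poch (-1) q K ^ 2 * invPoch 1 q K ^ 3

lemma map_prod_mul_invProdTrunc (hK : f q ^ K = 0) (hu : ∀ n, IsUnit (1 - 1 * q ^ (n + 1))) :
    f (poch 1 q K ^ 3 * oddPoch q K ^ 2 * invProdTrunc q K) = 1 := by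
  have h1 : poch 1 q K ^ 3 * oddPoch q K ^ 2 * invProdTrunc q K =
      (poch 1 q (2 * K) * invPoch 1 q K) ^ 2 := by
    rw [← poch_mul_poch_neg_mul_oddPoch, invProdTrunc]
    linear_combination (poch 1 q K ^ 2 * invPoch 1 q K ^ 2 * oddPoch q K ^ 2 * poch (-1) q K ^ 2) *
      poch_mul_invPoch 1 q hu K
  rw [h1, map_pow, map_mul, map_poch_of_le f hK 1 (by omega : K ≤ 2 * K), ← map_mul,
    poch_mul_invPoch 1 q hu, map_one, one_pow]

end Truncation

/-! ### Terms of the finite identity at high level -/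

section Limit

local notation "ζ" => onePlusEps ℚ⟦X⟧
local notation "ω" => oneSubEps ℚ⟦X⟧
local notation "𝔮" => (TrivSqZeroExt.inl ((X : ℚ⟦X⟧) ^ 2) : DualNumber ℚ⟦X⟧)

lemma exists_quotient_map {S : Type} [CommRing S] (x : S) :
    ∃ (T : Type) (_ : CommRing T) (f : S →+* T), f x = 0 ∧ ∀ F G, f F = f G → x ∣ F - G :=
  ⟨S ⧸ Ideal.span {x}, inferInstance, Ideal.Quotient.mk _,
    Ideal.Quotient.eq_zero_iff_mem.mpr (Ideal.mem_span_singleton_self x),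
    fun _ _ h => Ideal.mem_span_singleton.mp (Ideal.Quotient.eq.mp h)⟩

/-- `antisymValue` is linear over the scalars, so congruences of dual numbers descend to power
series. -/
lemma dvd_antisymValue_sub {K : ℕ} {F G : DualNumber ℚ⟦X⟧} (h : 𝔮 ^ K ∣ F - G) :
    ((X : ℚ⟦X⟧) ^ 2) ^ K ∣ antisymValue F - antisymValue G := by
  obtain ⟨c, hc⟩ := h
  rw [← map_sub, hc, TrivSqZeroExt.inl_pow, antisymValue_inl_mul]
  exact dvd_mul_right _ _

lemma map_real_part {T : Type*} [CommRing T] (f : DualNumber ℚ⟦X⟧ →+* T) {K : ℕ}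
    (hf : f 𝔮 ^ K = 0) {s d i j : ℕ} (hs : K ≤ s) (hd : K ≤ d) (hi : K ≤ i) (hj : K ≤ j) :
    f (TrivSqZeroExt.inl (poch (-1) (X ^ 2) s ^ 2 * invPoch 1 (X ^ 2) d ^ 2 *
        gauss (X ^ 2) (i + j) i)) = f (TrivSqZeroExt.inl (invProdTrunc (X ^ 2) K)) := by
  let g : ℚ⟦X⟧ →+* T := f.comp (TrivSqZeroExt.inlHom ℚ⟦X⟧ ℚ⟦X⟧)
  have hg : g (X ^ 2) ^ K = 0 := hf
  change g _ = g _
  rw [map_mul, map_mul, map_pow, map_pow, map_poch_of_le g hg _ hs,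
    map_invPoch_of_le g hg _ hd isUnit_one_sub_X_sq, map_gauss_of_le g hg isUnit_one_sub_X_sq hi hj,
    invProdTrunc, map_mul, map_pow, map_pow]
  ring

lemma map_prod_inverse_dual {T : Type*} [CommRing T] (f : DualNumber ℚ⟦X⟧ →+* T) {K : ℕ}
    (hf : f 𝔮 ^ K = 0) {d : ℕ} (hd : K ≤ d) (r : ℕ) :
    f (∏ i ∈ Finset.range r, Ring.inverse (1 - ζ ^ 2 * 𝔮 ^ (d + i + 1))) = 1 :=
  map_prod_inverse_eq_one f hf _ hd (isUnit_one_sub_sq_mul isUnit_one_sub_X_sq) r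

lemma map_product_term {T : Type*} [CommRing T] (f : DualNumber ℚ⟦X⟧ →+* T) {K : ℕ}
    (hf : f 𝔮 ^ K = 0) {s d i : ℕ} (hs : K ≤ s) (hd : K ≤ d) (hi : K ≤ i) (r : ℕ)
    (F : DualNumber ℚ⟦X⟧) :
    f ((∏ i ∈ Finset.range r, Ring.inverse (1 - ζ ^ 2 * 𝔮 ^ (d + i + 1))) *
      TrivSqZeroExt.inl (poch (-1) (X ^ 2) s ^ 2 * invPoch 1 (X ^ 2) d ^ 2 *
        gauss (X ^ 2) (i + d) i) * F) =
    f (TrivSqZeroExt.inl (invProdTrunc (X ^ 2) K) * F) := by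
  rw [map_mul, map_mul, map_prod_inverse_dual f hf hd, one_mul, map_real_part f hf hs hd hi hd,
    map_mul]

/-- Apart from a power of Q, only z^(3a-1) (z Q^a - 1) does not stabilise to the inverse product.
Its value yields 6a+1 for n = a and -(6a-1) = 6(-a)+1 for n = -a. -/
theorem evenTerm_limit (K a d : ℕ) (hd : K ≤ d) :
    ((X : ℚ⟦X⟧) ^ 2) ^ K ∣ antisymValue (ω * evenTerm 𝔮 ζ a (a + d)) -
      invProdTrunc (X ^ 2) K * ((X ^ 2) ^ (3 * a.choose 2 + a) *
        ((6 * (a : ℚ⟦X⟧) + 1) * (X ^ 2) ^ a - (6 * (a : ℚ⟦X⟧) - 1))) := by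
  have h1 := symNum_mul_invPoch_add (a + d) d (2 * a)
  rw [show d + 2 * a = a + d + a by omega] at h1
  have h2 := oneSubEps_pow_mul_onePlusEps_pow (2 * d)
  have hE : ω * evenTerm 𝔮 ζ a (a + d) =
      (∏ i ∈ Finset.range (2 * a), Ring.inverse (1 - ζ ^ 2 * 𝔮 ^ (d + i + 1))) *
      TrivSqZeroExt.inl (poch (-1) (X ^ 2) (a + d) ^ 2 * invPoch 1 (X ^ 2) d ^ 2 *
        gauss (X ^ 2) (2 * a + d + d) (2 * a + d)) *
      (TrivSqZeroExt.inl ((X ^ 2) ^ (3 * a.choose 2 + a)) *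
        (ω * ζ ^ (3 * a) * (ζ * 𝔮 ^ a - 1))) := by
    rw [evenTerm, show a + d - a = d by omega, gauss_inl, TrivSqZeroExt.inl_mul,
      ← TrivSqZeroExt.inl_pow _ (3 * a.choose 2 + a), show 2 * (a + d) = 2 * a + d + d by omega]
    rw [show a + d + a = 2 * a + d by omega] at h1 ⊢
    generalize (TrivSqZeroExt.inl (gauss (X ^ 2) (2 * a + d + d) (2 * a + d))
      : DualNumber ℚ⟦X⟧) = g at *
    generalize ∏ i ∈ Finset.range (2 * a), Ring.inverse (1 - ζ ^ 2 * 𝔮 ^ (d + i + 1)) = P at *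
    generalize (TrivSqZeroExt.inl (poch (-1) (X ^ 2) (a + d) ^ 2 * invPoch 1 (X ^ 2) d ^ 2)
      : DualNumber ℚ⟦X⟧) = c at *
    linear_combination (ω * 𝔮 ^ (3 * a.choose 2 + a) * ζ ^ (2 * a + d) * (ζ * 𝔮 ^ a - 1) * g) * h1
      + P * c * g * 𝔮 ^ (3 * a.choose 2 + a) * ω * ζ ^ (3 * a) * (ζ * 𝔮 ^ a - 1) * h2
  have hv : antisymValue (ω * ζ ^ (3 * a) * (ζ * 𝔮 ^ a - 1)) =
      (6 * (a : ℚ⟦X⟧) + 1) * (X ^ 2) ^ a - (6 * (a : ℚ⟦X⟧) - 1) := by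
    rw [TrivSqZeroExt.inl_pow, antisymValue_apply]
    simp [fst_onePlusEps, snd_onePlusEps, fst_oneSubEps, snd_oneSubEps]
    ring
  rw [← hv, ← antisymValue_inl_mul, ← antisymValue_inl_mul]
  apply dvd_antisymValue_sub
  obtain ⟨T, _, f, hf, hdvd⟩ := exists_quotient_map (𝔮 ^ K)
  refine hdvd _ _ ?_
  rw [map_pow] at hf
  rw [hE]
  exact map_product_term f hf (by omega) hd (by omega) _ _

theorem oddTerm_limit (K b d : ℕ) (hd : K ≤ d) :
    ((X : ℚ⟦X⟧) ^ 2) ^ K ∣ antisymValue (oddTerm 𝔮 ζ b (b + d)) -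
      invProdTrunc (X ^ 2) K * ((X ^ 2) ^ (3 * b.choose 2 + 2 * b) *
        ((6 * (b : ℚ⟦X⟧) + 1) - (6 * (b : ℚ⟦X⟧) + 5) * (X ^ 2) ^ (2 * b + 1))) := by
  have h1 := symNum_mul_invPoch_add (b + d) d (2 * b + 1)
  rw [show d + (2 * b + 1) = b + d + b + 1 by omega] at h1
  have h2 := oneSubEps_pow_mul_onePlusEps_pow (2 * d)
  have hE : oddTerm 𝔮 ζ b (b + d) =
      (∏ i ∈ Finset.range (2 * b + 1), Ring.inverse (1 - ζ ^ 2 * 𝔮 ^ (d + i + 1))) *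
      TrivSqZeroExt.inl (poch (-1) (X ^ 2) (b + d) ^ 2 * invPoch 1 (X ^ 2) d ^ 2 *
        gauss (X ^ 2) (2 * b + d + 1 + d) (2 * b + d + 1)) *
      (TrivSqZeroExt.inl ((X ^ 2) ^ (3 * b.choose 2 + 2 * b)) *
        (ζ ^ (3 * b) * (1 - ζ ^ 2 * 𝔮 ^ (2 * b + 1)))) := by
    rw [oddTerm, show b + d - b = d by omega, gauss_inl, TrivSqZeroExt.inl_mul,
      ← TrivSqZeroExt.inl_pow _ (3 * b.choose 2 + 2 * b), show 2 * (b + d) + 1 = 2 * b + d + 1 + d by omega]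
    rw [show b + d + b + 1 = 2 * b + d + 1 by omega] at h1 ⊢
    generalize (TrivSqZeroExt.inl (gauss (X ^ 2) (2 * b + d + 1 + d) (2 * b + d + 1))
      : DualNumber ℚ⟦X⟧) = g at *
    generalize ∏ i ∈ Finset.range (2 * b + 1), Ring.inverse (1 - ζ ^ 2 * 𝔮 ^ (d + i + 1)) = P at *
    generalize (TrivSqZeroExt.inl (poch (-1) (X ^ 2) (b + d) ^ 2 * invPoch 1 (X ^ 2) d ^ 2)
      : DualNumber ℚ⟦X⟧) = c at *
    linear_combination (𝔮 ^ (3 * b.choose 2 + 2 * b) * ζ ^ (2 * b + d) *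
      (1 - ζ ^ 2 * 𝔮 ^ (2 * b + 1)) * g) * h1
      + P * c * g * 𝔮 ^ (3 * b.choose 2 + 2 * b) * ζ ^ (3 * b) *
        (1 - ζ ^ 2 * 𝔮 ^ (2 * b + 1)) * h2
  have hv : antisymValue (ζ ^ (3 * b) * (1 - ζ ^ 2 * 𝔮 ^ (2 * b + 1))) =
      (6 * (b : ℚ⟦X⟧) + 1) - (6 * (b : ℚ⟦X⟧) + 5) * (X ^ 2) ^ (2 * b + 1) := by
    rw [TrivSqZeroExt.inl_pow, antisymValue_apply]
    simp [fst_onePlusEps, snd_onePlusEps]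
    ring
  rw [← hv, ← antisymValue_inl_mul, ← antisymValue_inl_mul]
  apply dvd_antisymValue_sub
  obtain ⟨T, _, f, hf, hdvd⟩ := exists_quotient_map (𝔮 ^ K)
  refine hdvd _ _ ?_
  rw [map_pow] at hf
  rw [hE]
  exact map_product_term f hf (by omega) hd (by omega) _ _

end Limit

/-! ### The infinite product modulo a power of q -/

section Product

/-- Factors beyond the n-th are 1 modulo X^N, and each coefficient is continuous, so the limit
agrees with the n-th partial product. -/
lemma dvd_qPochInf_sub (a q : ℚ⟦X⟧) (hq : constantCoeff q = 0) (N n : ℕ)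
    (h : ∀ i, n ≤ i → (X : ℚ⟦X⟧) ^ N ∣ a * q ^ i) :
    (X : ℚ⟦X⟧) ^ N ∣ qPochInf a q - ∏ i ∈ Finset.range n, (1 - a * q ^ i) := by
  have hpart : ∀ r, (X : ℚ⟦X⟧) ^ N ∣ ∏ i ∈ Finset.range (n + r), (1 - a * q ^ i) -
      ∏ i ∈ Finset.range n, (1 - a * q ^ i) := by
    intro r
    induction r with
    | zero => simp
    | succ r ih =>
      rw [← add_assoc, Finset.prod_range_succ, mul_sub, mul_one, sub_right_comm]
      exact dvd_sub ih (Dvd.dvd.mul_left (h _ (by omega)) _)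
  rw [X_pow_dvd_iff]
  intro m hm
  rw [map_sub, sub_eq_zero]
  have h1 := (multipliable_qPochInf a q hq).hasProd.tendsto_prod_nat
  have h2 := ((WithPiTopology.continuous_coeff ℚ m).tendsto _).comp h1
  refine tendsto_nhds_unique h2 (tendsto_const_nhds.congr' ?_)
  filter_upwards [Filter.eventually_ge_atTop n] with k hk
  obtain ⟨r, rfl⟩ := Nat.exists_eq_add_of_le hk
  have h3 := X_pow_dvd_iff.mp (hpart r) m hm
  rw [map_sub, sub_eq_zero] at h3
  exact h3.symm

lemma dvd_inv_prodSide_sub (K : ℕ) :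
    ((X : ℚ⟦X⟧) ^ 2) ^ K ∣ prodSide⁻¹ - invProdTrunc (X ^ 2) K := by
  set I := Ideal.span {((X : ℚ⟦X⟧) ^ 2) ^ K} with hI
  have hf : Ideal.Quotient.mk I (X ^ 2) ^ K = 0 := by
    rw [← map_pow, Ideal.Quotient.eq_zero_iff_mem]
    exact Ideal.mem_span_singleton_self _
  have e1 : Ideal.Quotient.mk I (qPochInf (X ^ 2) (X ^ 2)) =
      Ideal.Quotient.mk I (poch 1 (X ^ 2) K) := by
    rw [Ideal.Quotient.eq, Ideal.mem_span_singleton, ← pow_mul]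
    have := dvd_qPochInf_sub (X ^ 2) (X ^ 2) (by simp) (2 * K) K fun i hi => by
      rw [← pow_succ', ← pow_mul]; exact pow_dvd_pow _ (by omega)
    convert this using 2
    refine Finset.prod_congr rfl fun i _ => ?_
    rw [one_mul, pow_succ']
  have e2 : Ideal.Quotient.mk I (qPochInf (X ^ 2) (X ^ 4)) =
      Ideal.Quotient.mk I (oddPoch (X ^ 2) K) := by
    rw [Ideal.Quotient.eq, Ideal.mem_span_singleton, ← pow_mul]
    have := dvd_qPochInf_sub (X ^ 2) (X ^ 4) (by simp) (2 * K) K fun i hi => by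
      rw [← pow_mul, ← pow_add]; exact pow_dvd_pow _ (by omega)
    convert this using 2
    refine Finset.prod_congr rfl fun i _ => ?_
    ring
  have h1 := map_prod_mul_invProdTrunc (Ideal.Quotient.mk I) hf isUnit_one_sub_X_sq
  have h2 : Ideal.Quotient.mk I (prodSide * invProdTrunc (X ^ 2) K) = 1 := by
    rw [← h1, prodSide]
    simp only [map_mul, map_pow, e1, e2]
  rw [← Ideal.mem_span_singleton, ← Ideal.Quotient.eq]
  have h3 := congrArg (Ideal.Quotient.mk I) prodSide_mul_inv
  rw [map_mul] at h2 h3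
  rw [map_one] at h3
  linear_combination (Ideal.Quotient.mk I prodSide⁻¹) * (- h2) +
    (Ideal.Quotient.mk I (invProdTrunc (X ^ 2) K)) * h3

end Product

/-! ### Balanced ranges -/

section Final

local notation "ζ" => onePlusEps ℚ⟦X⟧
local notation "ω" => oneSubEps ℚ⟦X⟧
local notation "𝔮" => (TrivSqZeroExt.inl ((X : ℚ⟦X⟧) ^ 2) : DualNumber ℚ⟦X⟧)

lemma truncSum_add {a b c : ℤ} (hab : a ≤ b + 1) (hbc : b ≤ c) :
    truncSum a c = truncSum a b + truncSum (b + 1) c := by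
  rw [truncSum, truncSum, truncSum, ← Finset.sum_union]
  · refine Finset.sum_congr ?_ fun _ _ => rfl
    ext x
    simp only [Finset.mem_Icc, Finset.mem_union]
    omega
  · rw [Finset.disjoint_left]
    intro x hx hx'
    rw [Finset.mem_Icc] at hx hx'
    omega

lemma truncSum_self (a : ℤ) :
    truncSum a a = (6 * (a : ℚ⟦X⟧) + 1) * X ^ (3 * a ^ 2 + a).toNat := by
  simp [truncSum]

lemma truncSum_eq_zero {a b : ℤ} (h : b < a) : truncSum a b = 0 := by
  simp [truncSum, Finset.Icc_eq_empty_of_lt h]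

lemma cast_choose_two (a : ℕ) : 2 * ((a.choose 2 : ℕ) : ℤ) = (a : ℤ) ^ 2 - a := by
  induction a with
  | zero => simp
  | succ a ih => rw [choose_two_succ]; push_cast; linear_combination ih

lemma exponent_of_nonneg (a : ℕ) :
    (3 * (a : ℤ) ^ 2 + a).toNat = 2 * (3 * a.choose 2 + 2 * a) := by
  rw [show 3 * (a : ℤ) ^ 2 + a = ((2 * (3 * a.choose 2 + 2 * a) : ℕ) : ℤ) by
    push_cast; linear_combination -3 * cast_choose_two a, Int.toNat_natCast]

lemma exponent_neg (a : ℕ) :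
    (3 * (-(a : ℤ)) ^ 2 + (-(a : ℤ))).toNat = 2 * (3 * a.choose 2 + a) := by
  rw [show 3 * (-(a : ℤ)) ^ 2 + (-(a : ℤ)) = ((2 * (3 * a.choose 2 + a) : ℕ) : ℤ) by
    push_cast; linear_combination -3 * cast_choose_two a, Int.toNat_natCast]

lemma truncSum_neg_self (A : ℕ) :
    2 * truncSum (-A) A = 2 + 2 * ∑ a ∈ Finset.range A,
      (X ^ 2) ^ (3 * (a + 1).choose 2 + (a + 1)) *
        ((6 * ((a + 1 : ℕ) : ℚ⟦X⟧) + 1) * (X ^ 2) ^ (a + 1) - (6 * ((a + 1 : ℕ) : ℚ⟦X⟧) - 1)) := by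
  induction A with
  | zero => simp [truncSum_self]
  | succ A ih =>
    rw [truncSum_add (a := -((A + 1 : ℕ) : ℤ)) (b := -((A + 1 : ℕ) : ℤ)) (by omega) (by omega),
      truncSum_add (a := -((A + 1 : ℕ) : ℤ) + 1) (b := (A : ℤ)) (by omega) (by omega),
      show -((A + 1 : ℕ) : ℤ) + 1 = -(A : ℤ) by omega,
      show (A : ℤ) + 1 = ((A + 1 : ℕ) : ℤ) by omega, truncSum_self, truncSum_self,
      exponent_of_nonneg, exponent_neg, Finset.sum_range_succ, pow_mul, pow_mul]
    push_cast
    push_cast at ih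
    linear_combination ih

lemma truncSum_neg_succ_self (B : ℕ) :
    truncSum (-(B + 1 : ℕ)) B = ∑ b ∈ Finset.range (B + 1),
      (X ^ 2) ^ (3 * b.choose 2 + 2 * b) *
        ((6 * (b : ℚ⟦X⟧) + 1) - (6 * (b : ℚ⟦X⟧) + 5) * (X ^ 2) ^ (2 * b + 1)) := by
  have hterm : ∀ b : ℕ, truncSum (-(b + 1 : ℕ)) (-(b + 1 : ℕ)) + truncSum b b =
      (X ^ 2) ^ (3 * b.choose 2 + 2 * b) *
        ((6 * (b : ℚ⟦X⟧) + 1) - (6 * (b : ℚ⟦X⟧) + 5) * (X ^ 2) ^ (2 * b + 1)) := by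
    intro b
    rw [truncSum_self, truncSum_self, exponent_of_nonneg, exponent_neg, pow_mul, pow_mul,
      choose_two_succ]
    push_cast
    ring
  induction B with
  | zero =>
    rw [truncSum_add (b := -((0 + 1 : ℕ) : ℤ)) (by omega) (by simp), Finset.sum_range_one, ← hterm]
    simp
  | succ B ih =>
    rw [truncSum_add (a := -((B + 1 + 1 : ℕ) : ℤ)) (b := -((B + 1 + 1 : ℕ) : ℤ)) (by omega)
      (by omega),
      truncSum_add (a := -((B + 1 + 1 : ℕ) : ℤ) + 1) (b := (B : ℤ)) (by omega) (by omega),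
      show -((B + 1 + 1 : ℕ) : ℤ) + 1 = -((B + 1 : ℕ) : ℤ) by omega,
      show (B : ℤ) + 1 = ((B + 1 : ℕ) : ℤ) by omega, Finset.sum_range_succ, ← ih, ← hterm (B + 1)]
    ring

lemma coeff_eq_of_dvd_sub {f g : ℚ⟦X⟧} {k : ℕ} (h : (X ^ 2) ^ (k + 1) ∣ f - g) :
    coeff k f = coeff k g := by
  rw [← pow_mul] at h
  have := X_pow_dvd_iff.mp h k (by omega)
  rwa [map_sub, sub_eq_zero] at this

lemma invProdTrunc_mem (K : ℕ) : invProdTrunc ((X : ℚ⟦X⟧) ^ 2) K ∈ nonnegSeries :=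
  mul_mem (pow_mem (poch_neg_one_mem K) 2) (pow_mem (invPoch_one_mem K) 3)

lemma inv_prodSide_mem : prodSide⁻¹ ∈ nonnegSeries := fun k => by
  rw [coeff_eq_of_dvd_sub (dvd_inv_prodSide_sub (k + 1))]
  exact invProdTrunc_mem _ k

/-- The bound on m leaves m - a ≥ K for every a ≤ A, so all terms of the range have stabilised at
level m. -/
lemma even_congr (A K m : ℕ) (hm : A + K ≤ m) :
    ((X : ℚ⟦X⟧) ^ 2) ^ K ∣ 2 * (prodSide⁻¹ * truncSum (-A) A) - (2 + 2 * ∑ s ∈ Finset.range m,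
      antisymValue (ω * evenBoundary 𝔮 ζ (A + 1) s)) := by
  have h0 : ((X : ℚ⟦X⟧) ^ 2) ^ K ∣ antisymValue (ω * evenTerm 𝔮 ζ 0 m) -
      invProdTrunc (X ^ 2) K * 2 := by
    have := evenTerm_limit K 0 m (by omega)
    simp only [zero_add, Nat.choose_zero_succ, mul_zero, pow_zero, Nat.cast_zero] at this
    convert this using 2
    norm_num
  have h1 := Finset.dvd_sum (s := Finset.range A) (a := ((X : ℚ⟦X⟧) ^ 2) ^ K)
    fun a ha => evenTerm_limit K (a + 1) (m - (a + 1)) (by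
      rw [Finset.mem_range] at ha; omega)
  have h2 := dvd_mul_of_dvd_left (dvd_inv_prodSide_sub K) (2 * truncSum (-A) A)
  rw [← antisymValue_evenTerm_sum isUnit_one_sub_X_sq A m]
  rw [Finset.sum_sub_distrib, ← Finset.mul_sum, Finset.sum_congr rfl fun a ha => by
    rw [Nat.add_sub_cancel' (show a + 1 ≤ m by rw [Finset.mem_range] at ha; omega)]] at h1
  convert dvd_sub h2 (dvd_add h0 (h1.mul_left 2)) using 1
  linear_combination invProdTrunc (X ^ 2) K * truncSum_neg_self A

lemma odd_congr (B K m : ℕ) (hm : B + K ≤ m) :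
    ((X : ℚ⟦X⟧) ^ 2) ^ K ∣ prodSide⁻¹ * truncSum (-(B + 1 : ℕ)) B -
      (1 - ∑ s ∈ Finset.range m, antisymValue (oddBoundary 𝔮 ζ (B + 1) s)) := by
  have h1 := Finset.dvd_sum (s := Finset.range (B + 1)) (a := ((X : ℚ⟦X⟧) ^ 2) ^ K)
    fun b hb => oddTerm_limit K b (m - b) (by rw [Finset.mem_range] at hb; omega)
  have h2 := dvd_mul_of_dvd_left (dvd_inv_prodSide_sub K) (truncSum (-(B + 1 : ℕ)) B)
  rw [← antisymValue_oddTerm_sum isUnit_one_sub_X_sq B m]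
  rw [Finset.sum_sub_distrib, ← Finset.mul_sum, Finset.sum_congr rfl fun b hb => by
    rw [Nat.add_sub_cancel' (show b ≤ m by rw [Finset.mem_range] at hb; omega)]] at h1
  convert dvd_sub h2 h1 using 1
  linear_combination invProdTrunc (X ^ 2) K * truncSum_neg_succ_self B

theorem coeff_even_nonneg (A k : ℕ) : 0 ≤ coeff k (prodSide⁻¹ * truncSum (-A) A) := by
  have h := coeff_eq_of_dvd_sub (even_congr A (k + 1) (A + (k + 1)) le_rfl)
  have h1 : (2 + 2 * ∑ s ∈ Finset.range (A + (k + 1)),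
      antisymValue (ω * evenBoundary 𝔮 ζ (A + 1) s)) ∈ nonnegSeries := by
    rw [two_mul, ← one_add_one_eq_two]
    have := sum_mem (S := nonnegSeries) (t := Finset.range (A + (k + 1)))
      fun s _ => antisymValue_mem (evenBoundary_mem A s)
    exact add_mem (add_mem (one_mem _) (one_mem _)) (add_mem this this)
  have h2 := h1 k
  rw [← h, two_mul, map_add] at h2
  linarith

/-- The series is 1 minus a non-negative one, and the 1 is seen only by the constant coefficient. -/
theorem coeff_odd_nonpos (B k : ℕ) (hk : 1 ≤ k) :
    coeff k (prodSide⁻¹ * truncSum (-(B + 1 : ℕ)) B) ≤ 0 := by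
  rw [coeff_eq_of_dvd_sub (odd_congr B (k + 1) (B + (k + 1)) le_rfl), map_sub, coeff_one,
    if_neg (by omega), zero_sub, neg_nonpos]
  exact sum_mem (S := nonnegSeries) (t := Finset.range (B + (k + 1)))
    (fun s _ => antisymValue_mem (oddBoundary_mem B s)) k

lemma truncSum_mem {a : ℤ} (ha : 0 ≤ a) (b : ℤ) : truncSum a b ∈ nonnegSeries := by
  refine sum_mem fun n hn => mul_mem ?_ (pow_mem X_mem_nonnegSeries _)
  rw [Finset.mem_Icc] at hn
  obtain ⟨n, rfl⟩ := Int.eq_ofNat_of_zero_le (ha.trans hn.1)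
  exact_mod_cast natCast_mem nonnegSeries (6 * n + 1)

lemma neg_truncSum_mem (a : ℤ) {b : ℤ} (hb : b < 0) : -truncSum a b ∈ nonnegSeries := by
  rw [truncSum, ← Finset.sum_neg_distrib]
  refine sum_mem fun n hn => ?_
  rw [Finset.mem_Icc] at hn
  obtain ⟨m, rfl⟩ : ∃ m : ℕ, n = -(m + 1 : ℕ) := ⟨(-n - 1).toNat, by omega⟩
  rw [← neg_mul]
  refine mul_mem ?_ (pow_mem X_mem_nonnegSeries _)
  rw [show -(6 * ((-(m + 1 : ℕ) : ℤ) : ℚ⟦X⟧) + 1) = ((6 * m + 5 : ℕ) : ℚ⟦X⟧) by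
    push_cast; ring]
  exact natCast_mem nonnegSeries _

end Final

/-! ### Arbitrary ranges -/

theorem theorem1p7 (a b : ℤ) (k : ℕ) (hk : 1 ≤ k) :
    0 ≤ coeff k ((Sg (a + b) : ℚ⟦X⟧) * prodSide⁻¹ * truncSum a b) := by
  rcases lt_or_ge b a with hab | hab
  · simp [truncSum_eq_zero hab]
  rcases le_or_gt 0 (a + b) with hs | hs
  · rw [Sg, if_pos hs, Int.cast_one, one_mul]
    rcases le_or_gt 0 a with ha | ha
    · exact mul_mem inv_prodSide_mem (truncSum_mem ha b) k
    · obtain ⟨A, rfl⟩ : ∃ A : ℕ, a = -A := ⟨(-a).toNat, by omega⟩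
      -- Since A ≤ b, the range is [-A, A] followed by positive indices only.
      rw [truncSum_add (b := A) (by omega) (by omega), mul_add, map_add]
      exact add_nonneg (coeff_even_nonneg A k)
        (mul_mem inv_prodSide_mem (truncSum_mem (by omega) b) k)
  · rw [Sg, if_neg (by omega), Int.cast_neg, Int.cast_one, neg_one_mul, neg_mul, map_neg,
      neg_nonneg]
    have key : ∀ c : ℤ, c < 0 → coeff k (prodSide⁻¹ * truncSum a c) ≤ 0 := by
      intro c hc
      have := mul_mem inv_prodSide_mem (neg_truncSum_mem a hc) k
      rwa [mul_neg, map_neg, neg_nonneg] at this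
    rcases le_or_gt 0 b with hb | hb
    · obtain ⟨B, rfl⟩ := Int.eq_ofNat_of_zero_le hb
      -- Here a ≤ -B-1, so the range is [-B-1, B] preceded by a possibly empty block of negative
      -- indices.
      rw [truncSum_add (b := -(B + 1 : ℕ) - 1) (by omega) (by omega), sub_add_cancel, mul_add,
        map_add]
      exact add_nonpos (key _ (by omega)) (coeff_odd_nonpos B k hk)
    · exact key b hb
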